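/- Let $X_c=\{x_0,\dots,x_{m_c}\}$ and $X_d=\{\tilde x_0,\dots,\tilde x_{m_d}\}$ be alphabets and let $c\in\mathbb R^{m_d}\langle\langle X_c\rangle\rangle$, $d\in\mathbb R^{m_c}\langle\langle X_d\rangle\rangle$ be arbitrary noncommutative formal power series (maps from words to $\mathbb R^{m_d}$, resp. $\mathbb R^{m_c}$). Notation. Let $\mathbin{\sqcup\!\sqcup}$ be the shuffle product. For $a\in\mathbb R^{\ell}\langle\langle \{z_0,\dots,z_n\}\rangle\rangle$ and $b\in\mathbb R^{n}\langle\langle X\rangle\rangle$, $X=\{x_0,\dots,x_m\}$, the composition product is $a\circ b=\sum_\eta (a,\eta)\,\psi_b(\eta)(1)$, where $\psi_b(z_{i_1}\cdots z_{i_k})=\psi_b(z_{i_1})\cdots\psi_b(z_{i_k})$ and $\psi_b(z_i)(e)=x_0(b_i \mathbin{\sqcup\!\sqcup} e)$ with $b_0:=1$. For $a\in\mathbb R^{\ell}\langle\langle X\rangle\rangle$ and $b\in\mathbb R^m\langle\langle X\rangle\rangle$ the modified composition product is $a\,\tilde\circ\, b=\sum_\eta (a,\eta)\,\phi_b(\eta)(1)$,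 where $\phi_b$ is extended to words in the same way from $\phi_b(x_i)(e)=x_ie+x_0(b_i \mathbin{\sqcup\!\sqcup} e)$ with $b_0:=0$. With $\delta$ the (fictitious) generating series of the identity operator, let $a\circ(\delta+b)$ denote the composition product formed with $\psi_{\delta+b}(x_0)(e)=x_0e$ and $\psi_{\delta+b}(x_i)(e)=x_ie+x_0(b_i \mathbin{\sqcup\!\sqcup} e)$ for $i\ge 1$, and on the set of formal sums $\delta+b$, $b\in\mathbb R^m\langle\langle X\rangle\rangle$, put $(\delta+a)\circ(\delta+b)=\delta+b+a\,\tilde\circ\,b$. For a series $a$ over $\{x_0,\dots,x_m\}$ and a tuple $u=(u_1,\dots,u_m)$ of formal power series in $t$, let $F_a[u]=\sum_\eta (a,\eta)E_\eta[u]$ be the (formal) Fliess operator, where $E_\emptyset[u]=1$, $E_{x_i\eta}[u](t)=\int_0^t u_i(\tau)E_\eta[u](\tau)\,d\tau$ and $u_0:=1$. Theorem. (i) The formal sums $\delta+b$, $b\in\mathbb R^{m_c}\langle\langle X_c\rangle\rangle$, form a group under $\circ$ with unit $\delta$ (the output feedback group). Write $(\delta+b)^{-1}=\delta+b^{-1}$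 for its inverse. (ii) There is exactly one series $c@d\in\mathbb R^{m_d}\langle\langle X_c\rangle\rangle$, the feedback product, that generates the feedback connection of $F_c$ and $F_d$: for every input $u$, the equations $v=u+F_d[y]$, $y=F_c[v]$ hold for exactly one output $y$, namely $y=F_{c@d}[u]$. It is also the unique solution $e$ of $e=c\,\tilde\circ\,(d\circ e)$. (iii) $$c@d \;=\; c\,\tilde\circ\,(-d\circ c)^{-1} \;=\; c\circ(\delta-d\circ c)^{-1}.$$ -/

import Mathlib

noncomputable section

namespace FliessSeries

/-- Words over the alphabet `X = {x₀, x₁, …, x_m}`; the letter `x_i` is `i : Fin (m + 1)`. -/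
abbrev Word (m : ℕ) : Type := List (Fin (m + 1))

/-- Scalar formal power series `ℝ⟨⟨X⟩⟩`. -/
abbrev ScalarSeries (m : ℕ) : Type := Word m → ℝ

/-- Formal power series `ℝ^ℓ⟨⟨X⟩⟩`, i.e. maps `X* → ℝ^ℓ`. -/
abbrev Series (m ℓ : ℕ) : Type := Word m → Fin ℓ → ℝ

/-- The `i`-th component series of `c`. -/
def component {m ℓ : ℕ} (c : Series m ℓ) (i : Fin ℓ) : ScalarSeries m := fun η => c η i

/-- The series `1 = 1 ∅`. -/
def unit (m : ℕ) : ScalarSeries m := fun η => if η = [] then 1 else 0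

/-- The catenation `x_i e` of a letter and a series. -/
def letterMul {m : ℕ} (i : Fin (m + 1)) (e : ScalarSeries m) : ScalarSeries m
  | [] => 0
  | j :: η => if j = i then e η else 0

/-- The shuffle product of two words, as the list (with multiplicities) of the words in it. -/
def shuffleWords {m : ℕ} : Word m → Word m → List (Word m)
  | [], ξ => [ξ]
  | i :: η, [] => [i :: η]
  | i :: η, j :: ξ =>
      (shuffleWords η (j :: ξ)).map (fun ζ => i :: ζ) ++
        (shuffleWords (i :: η) ξ).map (fun ζ => j :: ζ)
termination_by η ξ => η.length + ξ.length

/-- The shuffle product of series, the bilinear extension of the shuffle product of words.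
For every word `ζ` only the finitely many pairs with `|η| + |ξ| = |ζ|` contribute. -/
def shuffle {m : ℕ} (c d : ScalarSeries m) : ScalarSeries m := fun ζ =>
  ∑ᶠ p : Word m × Word m, c p.1 * d p.2 * ((shuffleWords p.1 p.2).count ζ : ℝ)

/-- The multiplicative extension to words of a family of maps indexed by the letters of an
alphabet with `n + 1` letters: `x_{i₁} ⋯ x_{i_k} ↦ φ(x_{i₁}) ∘ ⋯ ∘ φ(x_{i_k})`. -/
def extendToWords {m n : ℕ} (φ : Fin (n + 1) → ScalarSeries m → ScalarSeries m) :
    Word n → ScalarSeries m → ScalarSeries m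
  | [], e => e
  | i :: η, e => φ i (extendToWords φ η e)

/-- `∑_η (c, η) φ(η)(1)`. In every use below `φ(x_i)` raises the order of a series by at least one,
so that for every word `ξ` only the finitely many `η` with `|η| ≤ |ξ|` contribute. -/
def substitute {m n ℓ : ℕ} (φ : Fin (n + 1) → ScalarSeries m → ScalarSeries m)
    (c : Series n ℓ) : Series m ℓ := fun ξ k =>
  ∑ᶠ η : Word n, c η k * extendToWords φ η (unit m) ξ

/-- `ψ_d(x_i)(e) = x₀ (d_i ⧢ e)` with `d₀ = 1`. -/
def psi {m n : ℕ} (d : Series m n) (i : Fin (n + 1)) (e : ScalarSeries m) : ScalarSeries m :=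
  letterMul 0 (shuffle (Fin.cases (unit m) (component d) i) e)

/-- The composition product `c ∘ d`, where `c` is a series over an alphabet with `n + 1` letters
and `d` is an `ℝⁿ`-valued series over a possibly different alphabet. -/
def comp {m n ℓ : ℕ} (c : Series n ℓ) (d : Series m n) : Series m ℓ := substitute (psi d) c

/-- `φ_d(x_i)(e) = x_i e + x₀ (d_i ⧢ e)` with `d₀ = 0`. -/
def phi {m : ℕ} (d : Series m m) (i : Fin (m + 1)) (e : ScalarSeries m) : ScalarSeries m :=
  letterMul i e + letterMul 0 (shuffle (Fin.cases 0 (component d) i) e)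

/-- The modified composition product of `c` and `d`. -/
def modComp {m ℓ : ℕ} (c : Series m ℓ) (d : Series m m) : Series m ℓ := substitute (phi d) c

/-- The formal sums `δ + c` with `c ∈ ℝ^m⟨⟨X⟩⟩`, where `δ` is the fictitious generating series of
the identity operator. The element `⟨c⟩` is `δ + c`. -/
@[ext]
structure DeltaSeries (m : ℕ) : Type where
  series : Series m m

/-- The unit of the output feedback group is `δ`. -/
instance (m : ℕ) : One (DeltaSeries m) := ⟨⟨0⟩⟩

/-- The product of the output feedback group:
`(δ + c) ∘ (δ + d) = δ + d + (modified composition of c and d)`. -/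
instance (m : ℕ) : Mul (DeltaSeries m) := ⟨fun a b => ⟨b.series + modComp a.series b.series⟩⟩

/-- The inverse in the output feedback group: the two-sided inverse with respect to the product
above. (That this structure is a group is asserted together with the main result.) -/
instance (m : ℕ) : Inv (DeltaSeries m) :=
  ⟨fun a => Classical.epsilon fun b => a * b = 1 ∧ b * a = 1⟩

/-- The series `c⁻¹` defined by `(δ + c)⁻¹ = δ + c⁻¹`. -/
def groupInv {m : ℕ} (c : Series m m) : Series m m := ((⟨c⟩ : DeltaSeries m)⁻¹).series

/-- `ψ_{δ+w}(x_i)(e) = x₀ ((δ_i + w_i) ⧢ e)`, where `x₀ (δ_i ⧢ e) = x_i e` because `δ_i` generates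
the `i`-th input; for `i = 0` the series in the bracket is `1`. -/
def psiDelta {m : ℕ} (a : DeltaSeries m) (i : Fin (m + 1)) (e : ScalarSeries m) :
    ScalarSeries m :=
  Fin.cases (letterMul 0 e)
    (fun j => letterMul j.succ e + letterMul 0 (shuffle (component a.series j) e)) i

/-- The composition product `c ∘ (δ + w)`. -/
def compDelta {m ℓ : ℕ} (c : Series m ℓ) (a : DeltaSeries m) : Series m ℓ :=
  substitute (psiDelta a) c

/-- Formal signals: `n`-tuples of formal power series in time. -/
abbrev Signal (n : ℕ) : Type := Fin n → PowerSeries ℝ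

/-- The formal integral from `0` to `t`. -/
def integral (f : PowerSeries ℝ) : PowerSeries ℝ :=
  PowerSeries.mk fun n => if n = 0 then 0 else PowerSeries.coeff (n - 1) f / (n : ℝ)

/-- The iterated integrals `E_∅[u] = 1`, `E_{x_i η}[u](t) = ∫₀ᵗ u_i E_η[u]`, with `u₀ = 1`. -/
def iteratedIntegral {m : ℕ} (u : Signal m) : Word m → PowerSeries ℝ
  | [] => 1
  | i :: η => integral (Fin.cases (1 : PowerSeries ℝ) u i * iteratedIntegral u η)

/-- The Fliess operator `F_c[u] = ∑_η (c, η) E_η[u]` on formal signals. It is defined for every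
series `c`: since `E_η[u]` has order at least `|η|`, only finitely many words contribute to each
coefficient. -/
def fliess {m ℓ : ℕ} (c : Series m ℓ) (u : Signal m) : Signal ℓ := fun k =>
  PowerSeries.mk fun n => ∑ᶠ η : Word m, c η k * PowerSeries.coeff n (iteratedIntegral u η)

/-- `e` is a generating series of the feedback connection of `F_c` (forward path) and `F_d`
(feedback path): for every input `u` the loop equations `v = u + F_d[y]`, `y = F_c[v]` hold for
exactly one output `y`, namely `y = F_e[u]`. -/
def IsFeedbackSeries {mc md : ℕ} (c : Series mc md) (d : Series md mc) (e : Series mc md) : Prop :=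
  ∀ (u : Signal mc) (y : Signal md),
    (∃ v : Signal mc, v = u + fliess d y ∧ y = fliess c v) ↔ y = fliess e u

/-- The feedback product `c @ d`: the generating series of the feedback connection. (Its existence
and uniqueness are asserted together with the main result.) -/
def feedback {mc md : ℕ} (c : Series mc md) (d : Series md mc) : Series mc md :=
  Classical.epsilon (IsFeedbackSeries c d)

end FliessSeries

end

open FliessSeries

/-!
The operators `F_c` satisfy the infinite linear system `F_c[u]' = ∑_i u_i F_{x_i⁻¹ c}[u]`,
`F_c[u](0) = (c, ∅)`. A solution of such a system is unique, and its coefficients of order at most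
`n` involve only the coefficients of order less than `n` of `u`. Uniqueness turns the products of
series into operations on operators: `F_{c ⧢ d} = F_c F_d`, `F_{c ∘ d} = F_c ∘ F_d`, and the
modified composition product of `c` and `d` generates `u ↦ F_c[u + F_d[u]]`. So `δ + b` acts on
signals by `u ↦ u + F_b[u]`, and this action respects `∘`.

The action is faithful because `c` is determined by `F_c`: as `p → ∞`, the coefficients of
`p (F_c[u + t ^ p e_i] - F_c[u]) / t ^ (p + 1)` tend to those of `F_{x_i⁻¹ c}[u]` for `i ≥ 1`, so
`F_c = 0` implies `F_{x_i⁻¹ c} = 0` for these `i`, hence for all `i` by the differential equation,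
and one concludes by induction on words. The group laws therefore follow from those of maps. A right
inverse of `δ + a` is a fixed point of `b ↦ -(a õ b)`, where `a õ b` is the modified composition
product; it exists since the coefficient of `a õ b` at a word involves `b` only at shorter words.

Finally, the loop equation `v = u + F_d[F_c[v]]` says that `δ - d ∘ c` maps `v` to `u`, that is,
`v` is the image of `u` under `(δ - d ∘ c)⁻¹`, and `y = F_c[v]`.
-/

noncomputable section

namespace FliessSeries

open PowerSeries

/-! ### Power series modulo powers of the variable -/

section Trunc

variable {R : Type*} [CommRing R] {f g : R⟦X⟧} {n : ℕ}

/-- The ideal `(X ^ n)` of `R⟦X⟧`: congruence modulo it is agreement of the coefficients of index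
less than `n`. -/
def truncIdeal (R : Type*) [CommRing R] (n : ℕ) : Ideal R⟦X⟧ := Ideal.span {X ^ n}

theorem smodEq_truncIdeal_iff :
    f ≡ g [SMOD truncIdeal R n] ↔ ∀ k < n, coeff k f = coeff k g := by
  simp [SModEq.sub_mem, truncIdeal, Ideal.mem_span_singleton, X_pow_dvd_iff, sub_eq_zero]

theorem truncIdeal_antitone : Antitone (truncIdeal R) := fun _ _ h =>
  Ideal.span_singleton_le_span_singleton.mpr (pow_dvd_pow X h)

theorem eq_of_forall_smodEq_truncIdeal (h : ∀ n, f ≡ g [SMOD truncIdeal R n]) : f = g :=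
  PowerSeries.ext fun n => smodEq_truncIdeal_iff.mp (h (n + 1)) n n.lt_succ_self

theorem smodEq_truncIdeal_succ_iff [IsAddTorsionFree R] :
    f ≡ g [SMOD truncIdeal R (n + 1)] ↔
      constantCoeff f = constantCoeff g ∧ d⁄dX R f ≡ d⁄dX R g [SMOD truncIdeal R n] := by
  have coeff_derivative_eq_iff (k : ℕ) :
      coeff k (d⁄dX R f) = coeff k (d⁄dX R g) ↔ coeff (k + 1) f = coeff (k + 1) g := by
    simp only [coeff_derivative, ← Nat.cast_succ, mul_comm _ (Nat.cast _), ← nsmul_eq_mul]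
    exact nsmul_right_inj k.succ_ne_zero
  simp only [smodEq_truncIdeal_iff, Nat.forall_lt_succ_left, coeff_zero_eq_constantCoeff,
    coeff_derivative_eq_iff]

variable [IsAddTorsionFree R] {ι κ : Type*} [Fintype κ] (σ : κ → ι → ι) {a b : κ → R⟦X⟧}
  {Φ Ψ : ι → R⟦X⟧}

theorem smodEq_truncIdeal_of_derivative_eq_sum (hab : ∀ k, a k ≡ b k [SMOD truncIdeal R n])
    (h0 : ∀ x, constantCoeff (Φ x) = constantCoeff (Ψ x))
    (hΦ : ∀ x, d⁄dX R (Φ x) = ∑ k, a k * Φ (σ k x))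
    (hΨ : ∀ x, d⁄dX R (Ψ x) = ∑ k, b k * Ψ (σ k x)) (x : ι) :
    Φ x ≡ Ψ x [SMOD truncIdeal R (n + 1)] := by
  induction n generalizing x with
  | zero => exact smodEq_truncIdeal_succ_iff.mpr ⟨h0 x, by simp [smodEq_truncIdeal_iff]⟩
  | succ n ih =>
    have hab' (k : κ) : a k ≡ b k [SMOD truncIdeal R n] :=
      (hab k).mono (truncIdeal_antitone n.le_succ)
    rw [smodEq_truncIdeal_succ_iff, hΦ, hΨ]
    exact ⟨h0 x, SModEq.sum fun k _ => (hab k).mul (ih hab' _)⟩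

theorem eq_of_derivative_eq_sum (h0 : ∀ x, constantCoeff (Φ x) = constantCoeff (Ψ x))
    (hΦ : ∀ x, d⁄dX R (Φ x) = ∑ k, a k * Φ (σ k x))
    (hΨ : ∀ x, d⁄dX R (Ψ x) = ∑ k, a k * Ψ (σ k x)) (x : ι) : Φ x = Ψ x :=
  eq_of_forall_smodEq_truncIdeal fun n =>
    (smodEq_truncIdeal_of_derivative_eq_sum σ (fun _ => SModEq.rfl) h0 hΦ hΨ x).mono
      (truncIdeal_antitone n.le_succ)

end Trunc

/-! ### Sums over words -/

section Words

variable {α : Type*} [Fintype α] {M : Type*} [AddCommMonoid M] {n : ℕ}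

/-- The finite set of words of length at most `n`, which carries the sums over all words that
have only finitely many nonzero terms. -/
def wordsUpTo (α : Type*) [Fintype α] (n : ℕ) : Finset (List α) :=
  (List.finite_length_le α n).toFinset

theorem mem_wordsUpTo {η : List α} : η ∈ wordsUpTo α n ↔ η.length ≤ n := by
  simp [wordsUpTo]

theorem wordsUpTo_zero : wordsUpTo α 0 = {[]} := by
  ext η
  simp [mem_wordsUpTo]

theorem finsum_eq_sum_wordsUpTo {f : List α → M} (hf : ∀ η, n < η.length → f η = 0) :
    ∑ᶠ η, f η = ∑ η ∈ wordsUpTo α n, f η :=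
  finsum_eq_sum_of_support_subset f fun η hη =>
    mem_wordsUpTo.mpr (not_lt.mp (mt (hf η) hη))

theorem sum_wordsUpTo_succ (f : List α → M) :
    ∑ η ∈ wordsUpTo α (n + 1), f η = f [] + ∑ i, ∑ η ∈ wordsUpTo α n, f (i :: η) := by
  classical
  have wordsUpTo_succ : wordsUpTo α (n + 1) =
      insert [] ((Finset.univ ×ˢ wordsUpTo α n).image fun p => p.1 :: p.2) := by
    ext η
    cases η <;> simp [mem_wordsUpTo]
  rw [wordsUpTo_succ, Finset.sum_insert (by simp),
    Finset.sum_image (fun p _ q _ h => Prod.ext (List.cons.inj h).1 (List.cons.inj h).2),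
    Finset.sum_product]

end Words

/-! ### The shuffle product -/

section Shuffle

/-- The left shift `x_i⁻¹ c` of a series `c`. -/
def shift {m : ℕ} (i : Fin (m + 1)) (c : ScalarSeries m) : ScalarSeries m := fun η => c (i :: η)

/-- The unshuffle coproduct of a word, dual to the shuffle product: the list (with multiplicities)
of the pairs formed by a subword and the complementary subword. -/
def unshuffles {α : Type*} : List α → List (List α × List α)
  | [] => [([], [])]
  | i :: ζ => (unshuffles ζ).map (Prod.map (i :: ·) id) ++ (unshuffles ζ).map (Prod.map id (i :: ·))

theorem finsum_mul_count {α R : Type*} [BEq α] [LawfulBEq α] [Semiring R] (f : α → R)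
    (l : List α) : ∑ᶠ x, f x * (l.count x : R) = (l.map f).sum := by
  classical
  rw [Finset.sum_list_map_count, finsum_eq_sum_of_support_subset (s := l.toFinset)]
  · simp only [nsmul_eq_mul, Nat.cast_comm]
    congr!
  · refine fun x hx => List.mem_toFinset.mpr ?_
    contrapose! hx
    simp [List.count_eq_zero_of_not_mem hx]

variable {m : ℕ} (i : Fin (m + 1)) (a b c d : ScalarSeries m) {ζ : Word m}

theorem count_map_cons {α : Type*} [DecidableEq α] (i j : α) (ζ : List α) (l : List (List α)) :
    (l.map (i :: ·)).count (j :: ζ) = if i = j then l.count ζ else 0 := by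
  split_ifs with h
  · rw [h, List.count_map_of_injective l _ List.cons_injective]
  · simp [List.count_eq_zero, h]

theorem count_map_cons_left {α : Type*} [DecidableEq α] (i : α) (η ξ : List α)
    (l : List (List α × List α)) :
    (l.map (Prod.map (i :: ·) id)).count (η, ξ) =
      if η.head? = some i then l.count (η.tail, ξ) else 0 := by
  split_ifs with h
  · obtain ⟨η, rfl⟩ := List.head?_eq_some_iff.mp h
    exact List.count_map_of_injective l _ (List.cons_injective.prodMap Function.injective_id) (η, ξ)
  · refine List.count_eq_zero.mpr fun hmem => h ?_
    obtain ⟨p, -, ⟨⟩⟩ := List.mem_map.mp hmem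
    rfl

theorem count_map_cons_right {α : Type*} [DecidableEq α] (i : α) (η ξ : List α)
    (l : List (List α × List α)) :
    (l.map (Prod.map id (i :: ·))).count (η, ξ) =
      if ξ.head? = some i then l.count (η, ξ.tail) else 0 := by
  split_ifs with h
  · obtain ⟨ξ, rfl⟩ := List.head?_eq_some_iff.mp h
    exact List.count_map_of_injective l _ (Function.injective_id.prodMap List.cons_injective) (η, ξ)
  · refine List.count_eq_zero.mpr fun hmem => h ?_
    obtain ⟨p, -, ⟨⟩⟩ := List.mem_map.mp hmem
    rfl

theorem shuffleWords_nil_right (η : Word m) : shuffleWords η [] = [η] := by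
  cases η <;> simp [shuffleWords]

theorem count_shuffleWords (η ξ ζ : Word m) :
    (shuffleWords η ξ).count ζ = (unshuffles ζ).count (η, ξ) := by
  induction ζ generalizing η ξ with
  | nil => cases η <;> cases ξ <;> simp [shuffleWords, unshuffles, List.count_eq_zero]
  | cons k ζ ih =>
    rw [unshuffles, List.count_append, count_map_cons_left, count_map_cons_right, ← ih, ← ih]
    rcases η with - | ⟨i, η⟩ <;> rcases ξ with - | ⟨j, ξ⟩
    · simp [shuffleWords]
    · simp [shuffleWords, List.count_singleton, ite_and]
    · simp [shuffleWords_nil_right, List.count_singleton, ite_and]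
    · simp [shuffleWords, count_map_cons]

theorem shuffle_eq_sum_unshuffles (ζ : Word m) :
    shuffle c d ζ = ((unshuffles ζ).map fun p : Word m × Word m => c p.1 * d p.2).sum := by
  simp only [shuffle, count_shuffleWords]
  exact finsum_mul_count (fun p : Word m × Word m => c p.1 * d p.2) _

theorem shuffle_nil : shuffle c d [] = c [] * d [] := by
  simp [shuffle_eq_sum_unshuffles, unshuffles]

theorem shuffle_cons (ζ : Word m) :
    shuffle c d (i :: ζ) = shuffle (shift i c) d ζ + shuffle c (shift i d) ζ := by
  simp [shuffle_eq_sum_unshuffles, unshuffles, Function.comp_def, shift]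

variable {a b c d} in
theorem shuffle_congr (hab : ∀ η : Word m, η.length ≤ ζ.length → a η = b η)
    (hcd : ∀ η : Word m, η.length ≤ ζ.length → c η = d η) : shuffle a c ζ = shuffle b d ζ := by
  induction ζ generalizing a b c d with
  | nil => simp [shuffle_nil, hab, hcd]
  | cons i ζ ih =>
    have of_le {e e' : ScalarSeries m} (h : ∀ η : Word m, η.length ≤ (i :: ζ).length → e η = e' η)
        (η : Word m) (hη : η.length ≤ ζ.length) : e η = e' η ∧ shift i e η = shift i e' η :=
      ⟨h η (Nat.le_succ_of_le hη), h (i :: η) (Nat.succ_le_succ hη)⟩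
    rw [shuffle_cons, shuffle_cons]
    exact congrArg₂ _
      (ih (fun η hη => (of_le hab η hη).2) fun η hη => (of_le hcd η hη).1)
      (ih (fun η hη => (of_le hab η hη).1) fun η hη => (of_le hcd η hη).2)

/-- The shuffle product as a bilinear map. -/
def shuffleBilin (m : ℕ) : ScalarSeries m →ₗ[ℝ] ScalarSeries m →ₗ[ℝ] ScalarSeries m :=
  LinearMap.mk₂ ℝ shuffle
    (fun a b c => funext fun ζ => by
      simp [shuffle_eq_sum_unshuffles, add_mul, List.sum_map_add])
    (fun r a c => funext fun ζ => by
      simp [shuffle_eq_sum_unshuffles, mul_assoc, List.sum_map_mul_left])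
    (fun a b c => funext fun ζ => by
      simp [shuffle_eq_sum_unshuffles, mul_add, List.sum_map_add])
    (fun r a c => funext fun ζ => by
      simp [shuffle_eq_sum_unshuffles, mul_left_comm _ r, List.sum_map_mul_left])

theorem shift_shuffle :
    shift i (shuffle c d) = shuffle (shift i c) d + shuffle c (shift i d) :=
  funext (shuffle_cons i c d)

theorem shuffleBilin_apply : shuffleBilin m c d = shuffle c d := rfl

theorem zero_shuffle : shuffle 0 d = 0 := (shuffleBilin m).map_zero₂ d

theorem shuffle_zero : shuffle d 0 = 0 := (shuffleBilin m d).map_zero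

theorem add_shuffle : shuffle (a + b) d = shuffle a d + shuffle b d :=
  (shuffleBilin m).map_add₂ a b d

theorem shift_unit : shift i (unit m) = 0 := funext fun ζ => by simp [shift, unit]

theorem unit_shuffle : shuffle (unit m) d = d := by
  funext ζ
  induction ζ generalizing d with
  | nil => simp [shuffle_nil, unit]
  | cons i ζ ih => rw [shuffle_cons, ih, shift_unit, zero_shuffle, Pi.zero_apply, zero_add, shift]

end Shuffle

/-! ### Fliess operators of scalar series -/

section ScalarFliess

variable {m : ℕ}

/-- The input `u` extended by `u₀ = 1`. -/
def extendedInput (u : Signal m) : Fin (m + 1) → ℝ⟦X⟧ := Fin.cons 1 u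

theorem iteratedIntegral_nil (u : Signal m) : iteratedIntegral u [] = 1 := rfl

theorem iteratedIntegral_cons (u : Signal m) (i : Fin (m + 1)) (η : Word m) :
    iteratedIntegral u (i :: η) = integral (extendedInput u i * iteratedIntegral u η) := rfl

theorem constantCoeff_integral (f : ℝ⟦X⟧) : constantCoeff (integral f) = 0 := by
  simp [integral, ← coeff_zero_eq_constantCoeff_apply]

theorem derivative_integral (f : ℝ⟦X⟧) : d⁄dX ℝ (integral f) = f := by
  ext n
  rw [coeff_derivative, integral, coeff_mk, if_neg n.succ_ne_zero, Nat.add_sub_cancel,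
    Nat.cast_succ, div_mul_cancel₀ _ n.cast_add_one_ne_zero]

theorem iteratedIntegral_smodEq_zero (u : Signal m) (η : Word m) :
    iteratedIntegral u η ≡ 0 [SMOD truncIdeal ℝ η.length] := by
  induction η with
  | nil => simp [smodEq_truncIdeal_iff]
  | cons i η ih =>
    rw [iteratedIntegral_cons, List.length_cons, smodEq_truncIdeal_succ_iff,
      constantCoeff_integral, derivative_integral]
    simpa using (SModEq.refl (extendedInput u i)).mul ih

theorem coeff_iteratedIntegral_eq_zero (u : Signal m) {η : Word m} {n : ℕ} (h : n < η.length) :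
    coeff n (iteratedIntegral u η) = 0 :=
  smodEq_truncIdeal_iff.mp (iteratedIntegral_smodEq_zero u η) n h

theorem finsum_mul_coeff_iteratedIntegral (u : Signal m) (c : ScalarSeries m) {n N : ℕ}
    (h : n ≤ N) : ∑ᶠ η, c η * coeff n (iteratedIntegral u η) =
      ∑ η ∈ wordsUpTo (Fin (m + 1)) N, c η * coeff n (iteratedIntegral u η) :=
  finsum_eq_sum_wordsUpTo fun η hη => by
    rw [coeff_iteratedIntegral_eq_zero u (h.trans_lt hη), mul_zero]

/-- The Fliess operator of a scalar series, as a linear function of the series. -/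
def scalarFliess (u : Signal m) : ScalarSeries m →ₗ[ℝ] ℝ⟦X⟧ where
  toFun c := PowerSeries.mk fun n => ∑ᶠ η, c η * coeff n (iteratedIntegral u η)
  map_add' c d := by
    ext n
    simp only [map_add, coeff_mk, finsum_mul_coeff_iteratedIntegral u _ le_rfl]
    simp [add_mul, Finset.sum_add_distrib]
  map_smul' r c := by
    ext n
    simp only [map_smul, coeff_mk, finsum_mul_coeff_iteratedIntegral u _ le_rfl]
    simp [mul_assoc, Finset.mul_sum]

theorem fliess_apply {ℓ : ℕ} (c : Series m ℓ) (u : Signal m) (k : Fin ℓ) :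
    fliess c u k = scalarFliess u (component c k) := rfl

variable (u : Signal m) (c d : ScalarSeries m)

theorem scalarFliess_smodEq (N : ℕ) :
    scalarFliess u c ≡ ∑ η ∈ wordsUpTo (Fin (m + 1)) N, c η • iteratedIntegral u η
      [SMOD truncIdeal ℝ (N + 1)] :=
  smodEq_truncIdeal_iff.mpr fun n hn => by
    simp [scalarFliess, finsum_mul_coeff_iteratedIntegral u c (Nat.le_of_lt_succ hn)]

theorem constantCoeff_scalarFliess : constantCoeff (scalarFliess u c) = c [] := by
  simpa [wordsUpTo_zero, iteratedIntegral_nil] using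
    (smodEq_truncIdeal_succ_iff.mp (scalarFliess_smodEq u c 0)).1

theorem derivative_scalarFliess :
    d⁄dX ℝ (scalarFliess u c) = ∑ i, extendedInput u i * scalarFliess u (shift i c) := by
  refine eq_of_forall_smodEq_truncIdeal fun N => SModEq.trans (y :=
    ∑ i, extendedInput u i *
      ∑ η ∈ wordsUpTo (Fin (m + 1)) N, shift i c η • iteratedIntegral u η) ?_ ?_
  · convert (smodEq_truncIdeal_succ_iff.mp
      ((scalarFliess_smodEq u c (N + 1)).mono (truncIdeal_antitone (N + 1).le_succ))).2 using 1
    simp [sum_wordsUpTo_succ, iteratedIntegral_cons, iteratedIntegral_nil, derivative_integral,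
      shift, Finset.mul_sum]
  · exact SModEq.sum fun i _ => SModEq.rfl.mul
      ((scalarFliess_smodEq u (shift i c) N).mono (truncIdeal_antitone N.le_succ)).symm

theorem scalarFliess_unit : scalarFliess u (unit m) = 1 := by
  refine derivative.ext ?_ ?_
  · simp [derivative_scalarFliess, shift_unit]
  · simp [constantCoeff_scalarFliess, unit]

theorem scalarFliess_shuffle :
    scalarFliess u (shuffle c d) = scalarFliess u c * scalarFliess u d := by
  let σ : Fin (m + 1) ⊕ Fin (m + 1) → ScalarSeries m × ScalarSeries m →
      ScalarSeries m × ScalarSeries m :=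
    Sum.elim (fun i => Prod.map (shift i) id) fun i => Prod.map id (shift i)
  refine eq_of_derivative_eq_sum σ (a := Sum.elim (extendedInput u) (extendedInput u))
    (Φ := fun p => scalarFliess u (shuffle p.1 p.2))
    (Ψ := fun p => scalarFliess u p.1 * scalarFliess u p.2) ?_ ?_ ?_ (c, d)
  · simp [constantCoeff_scalarFliess, shuffle_nil]
  · simp [σ, derivative_scalarFliess, shift_shuffle, mul_add, Finset.sum_add_distrib]
  · intro p
    simp only [Derivation.leibniz, derivative_scalarFliess, smul_eq_mul, Finset.mul_sum,
      Fintype.sum_sum_type, σ, Sum.elim_inl, Sum.elim_inr, Prod.map_fst, Prod.map_snd, id_eq]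
    rw [add_comm]
    congr! 2 <;> ring

variable {u} in
theorem scalarFliess_smodEq_of_smodEq {v : Signal m} {n : ℕ}
    (h : ∀ i, extendedInput u i ≡ extendedInput v i [SMOD truncIdeal ℝ n]) :
    scalarFliess u c ≡ scalarFliess v c [SMOD truncIdeal ℝ (n + 1)] :=
  smodEq_truncIdeal_of_derivative_eq_sum shift h
    (fun c => by simp only [constantCoeff_scalarFliess])
    (derivative_scalarFliess u) (derivative_scalarFliess v) c

end ScalarFliess

/-! ### Substitutions -/

section Substitute

variable {m n : ℕ}

/-- The letter maps `x_i ↦ (e ↦ ∑_j x_j (W_{ji} ⧢ e))` with kernel `W`. Both `ψ_d` and `φ_d` are of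
this form. -/
def shuffleMap (W : Fin (m + 1) → Fin (n + 1) → ScalarSeries m) (i : Fin (n + 1))
    (e : ScalarSeries m) : ScalarSeries m :=
  ∑ j, letterMul j (shuffle (W j i) e)

/-- The component of `substitute` for the letter maps with kernel `W`. -/
def scalarSubstitute (W : Fin (m + 1) → Fin (n + 1) → ScalarSeries m) (c : ScalarSeries n) :
    ScalarSeries m := fun ξ =>
  ∑ᶠ η, c η * extendToWords (shuffleMap W) η (unit m) ξ

theorem component_substitute_shuffleMap {ℓ : ℕ}
    (W : Fin (m + 1) → Fin (n + 1) → ScalarSeries m) (c : Series n ℓ) (k : Fin ℓ) :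
    component (substitute (shuffleMap W) c) k = scalarSubstitute W (component c k) := rfl

variable (W : Fin (m + 1) → Fin (n + 1) → ScalarSeries m) (c : ScalarSeries n)

theorem shuffleMap_nil (i : Fin (n + 1)) (e : ScalarSeries m) : shuffleMap W i e [] = 0 := by
  simp [shuffleMap, letterMul]

theorem shuffleMap_cons (i : Fin (n + 1)) (e : ScalarSeries m) (j : Fin (m + 1)) (ξ : Word m) :
    shuffleMap W i e (j :: ξ) = shuffle (W j i) e ξ := by
  simp [shuffleMap, letterMul]

theorem extendToWords_shuffleMap_eq_zero (e : ScalarSeries m) {η : Word n} {ξ : Word m}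
    (h : ξ.length < η.length) : extendToWords (shuffleMap W) η e ξ = 0 := by
  induction η generalizing ξ with
  | nil => exact absurd h (Nat.not_lt_zero _)
  | cons i η ih =>
    cases ξ with
    | nil => exact shuffleMap_nil W i _
    | cons j ξ =>
      have hη (ζ : Word m) (hζ : ζ.length ≤ ξ.length) : extendToWords (shuffleMap W) η e ζ = 0 :=
        ih (hζ.trans_lt (Nat.lt_of_succ_lt_succ h))
      rw [extendToWords, shuffleMap_cons, shuffle_congr (fun _ _ => rfl) hη, ← Pi.zero_def,
        shuffle_zero, Pi.zero_apply]

theorem scalarSubstitute_eq_sum {ξ : Word m} {N : ℕ} (h : ξ.length ≤ N) :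
    scalarSubstitute W c ξ = (∑ η ∈ wordsUpTo (Fin (n + 1)) N,
      c η • extendToWords (shuffleMap W) η (unit m)) ξ := by
  rw [Finset.sum_apply]
  exact finsum_eq_sum_wordsUpTo fun η hη => by
    rw [extendToWords_shuffleMap_eq_zero W _ (h.trans_lt hη), mul_zero]

theorem scalarSubstitute_nil : scalarSubstitute W c [] = c [] := by
  rw [scalarSubstitute_eq_sum W c le_rfl]
  simp [wordsUpTo_zero, extendToWords, unit]

theorem scalarSubstitute_cons (j : Fin (m + 1)) (ξ : Word m) :
    scalarSubstitute W c (j :: ξ) =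
      ∑ i, shuffle (W j i) (scalarSubstitute W (shift i c)) ξ := by
  have shuffle_scalarSubstitute (i : Fin (n + 1)) :
      shuffle (W j i) (scalarSubstitute W (shift i c)) ξ =
        ∑ η ∈ wordsUpTo (Fin (n + 1)) ξ.length,
          c (i :: η) * extendToWords (shuffleMap W) (i :: η) (unit m) (j :: ξ) := by
    rw [shuffle_congr (fun _ _ => rfl) fun ζ => scalarSubstitute_eq_sum W (shift i c),
      ← shuffleBilin_apply, map_sum, Finset.sum_apply]
    simp [shift, extendToWords, shuffleMap_cons, shuffleBilin_apply]
  rw [scalarSubstitute_eq_sum W c le_rfl, Finset.sum_apply, List.length_cons, sum_wordsUpTo_succ]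
  simp [shuffle_scalarSubstitute, extendToWords, unit]

theorem shift_scalarSubstitute (j : Fin (m + 1)) :
    shift j (scalarSubstitute W c) = ∑ i, shuffle (W j i) (scalarSubstitute W (shift i c)) :=
  funext fun ξ => by rw [Finset.sum_apply, ← scalarSubstitute_cons, shift]

variable {W} in
theorem scalarSubstitute_congr {W' : Fin (m + 1) → Fin (n + 1) → ScalarSeries m} {ξ : Word m}
    (h : ∀ j i (η : Word m), η.length < ξ.length → W j i η = W' j i η) :
    scalarSubstitute W c ξ = scalarSubstitute W' c ξ := by
  induction hN : ξ.length using Nat.strong_induction_on generalizing c ξ with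
  | _ N ih =>
    subst hN
    cases ξ with
    | nil => rw [scalarSubstitute_nil, scalarSubstitute_nil]
    | cons j ξ =>
      rw [scalarSubstitute_cons, scalarSubstitute_cons]
      refine Finset.sum_congr rfl fun i _ => shuffle_congr ?_ fun η hη => ?_
      · exact fun η hη => h j i η (Nat.lt_succ_of_le hη)
      · have hηξ : η.length < (j :: ξ).length := Nat.lt_succ_of_le hη
        exact ih _ hηξ _ (fun j i ζ hζ => h j i ζ (hζ.trans hηξ)) rfl

theorem scalarFliess_scalarSubstitute {u : Signal m} {v : Signal n}
    (h : ∀ i, ∑ j, extendedInput u j * scalarFliess u (W j i) = extendedInput v i) :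
    scalarFliess u (scalarSubstitute W c) = scalarFliess v c := by
  refine eq_of_derivative_eq_sum shift (Φ := fun c => scalarFliess u (scalarSubstitute W c))
    (fun c => ?_) (fun c => ?_) (derivative_scalarFliess v) c
  · simp only [constantCoeff_scalarFliess, scalarSubstitute_nil]
  · simp only [derivative_scalarFliess, shift_scalarSubstitute, map_sum, scalarFliess_shuffle, ← h,
      Finset.mul_sum, Finset.sum_mul, mul_assoc]
    exact Finset.sum_comm

end Substitute

/-! ### The composition products -/

section Comp

variable {m n ℓ : ℕ}

/-- The kernel of the letter maps `ψ_d`. -/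
def psiKernel (d : Series m n) : Fin (m + 1) → Fin (n + 1) → ScalarSeries m :=
  Pi.single 0 (Fin.cons (unit m) (component d))

/-- The kernel of the letter maps `φ_d`. -/
def phiKernel (d : Series m m) : Fin (m + 1) → Fin (m + 1) → ScalarSeries m :=
  (fun j => Pi.single j (unit m)) + Pi.single 0 (Fin.cons 0 (component d))

theorem psi_eq_shuffleMap (d : Series m n) : psi d = shuffleMap (psiKernel d) := by
  ext i e ξ
  cases ξ with
  | nil => rw [shuffleMap_nil, psi, letterMul]
  | cons j ξ =>
    rw [shuffleMap_cons, psi, letterMul]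
    split_ifs with hj
    · simp [psiKernel, hj, Fin.cons]
    · simp [psiKernel, hj, zero_shuffle]

theorem phi_eq_shuffleMap (d : Series m m) : phi d = shuffleMap (phiKernel d) := by
  ext i e ξ
  cases ξ with
  | nil => simp [shuffleMap_nil, phi, letterMul]
  | cons j ξ =>
    rw [shuffleMap_cons, phiKernel, Pi.add_apply, Pi.add_apply, add_shuffle, phi]
    simp only [Pi.add_apply, letterMul]
    congr 1
    · split_ifs with h
      · simp [h, unit_shuffle]
      · simp [Ne.symm h, zero_shuffle]
    · split_ifs with hj
      · simp [hj, Fin.cons]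
      · simp [hj, zero_shuffle]

theorem component_comp (c : Series n ℓ) (d : Series m n) (k : Fin ℓ) :
    component (comp c d) k = scalarSubstitute (psiKernel d) (component c k) := by
  rw [comp, psi_eq_shuffleMap, component_substitute_shuffleMap]

theorem component_modComp (c : Series m ℓ) (d : Series m m) (k : Fin ℓ) :
    component (modComp c d) k = scalarSubstitute (phiKernel d) (component c k) := by
  rw [modComp, phi_eq_shuffleMap, component_substitute_shuffleMap]

theorem sum_extendedInput_mul_scalarFliess_single_zero (u : Signal m)
    (b : Fin (n + 1) → ScalarSeries m) (i : Fin (n + 1)) :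
    ∑ j, extendedInput u j * scalarFliess u ((Pi.single 0 b : Fin (m + 1) → _) j i) =
      scalarFliess u (b i) := by
  simp [Fin.sum_univ_succ, extendedInput]

theorem fliess_comp (c : Series n ℓ) (d : Series m n) (u : Signal m) :
    fliess (comp c d) u = fliess c (fliess d u) := by
  ext1 k
  rw [fliess_apply, component_comp, fliess_apply]
  refine scalarFliess_scalarSubstitute _ _ fun i => ?_
  rw [psiKernel, sum_extendedInput_mul_scalarFliess_single_zero]
  cases i using Fin.cases <;> simp [extendedInput, scalarFliess_unit, fliess_apply]

theorem fliess_modComp (c : Series m ℓ) (d : Series m m) (u : Signal m) :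
    fliess (modComp c d) u = fliess c (u + fliess d u) := by
  ext1 k
  rw [fliess_apply, component_modComp, fliess_apply]
  refine scalarFliess_scalarSubstitute _ _ fun i => ?_
  have sum_unit : ∑ j, extendedInput u j * scalarFliess u
      ((Pi.single j (unit m) : Fin (m + 1) → ScalarSeries m) i) = extendedInput u i := by
    rw [Finset.sum_eq_single i (fun j _ hj => by simp [hj.symm]) (by simp)]
    simp [scalarFliess_unit]
  simp only [phiKernel, Pi.add_apply, map_add, mul_add, Finset.sum_add_distrib, sum_unit,
    sum_extendedInput_mul_scalarFliess_single_zero]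
  cases i using Fin.cases <;> simp [extendedInput, fliess_apply]

theorem modComp_congr (c : Series m ℓ) {d d' : Series m m} {ξ : Word m}
    (h : ∀ η : Word m, η.length < ξ.length → d η = d' η) : modComp c d ξ = modComp c d' ξ := by
  ext k
  change component (modComp c d) k ξ = component (modComp c d') k ξ
  rw [component_modComp, component_modComp]
  refine scalarSubstitute_congr _ fun j i η hη => ?_
  cases i using Fin.cases <;> cases j using Fin.cases <;>
    simp [phiKernel, component, h η hη]

theorem compDelta_eq_modComp (c : Series m ℓ) (a : DeltaSeries m) :
    compDelta c a = modComp c a.series := by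
  have psiDelta_eq_phi : psiDelta a = phi a.series := by
    ext i e ξ
    cases i using Fin.cases with
    | zero => cases ξ <;> simp [psiDelta, phi, zero_shuffle, letterMul]
    | succ i => rfl
  rw [compDelta, modComp, psiDelta_eq_phi]

end Comp

/-! ### A series is determined by its Fliess operator -/

section Injective

open Filter Topology

variable {m : ℕ} (u : Signal m) (i : Fin m)

/-- The input `u` with `X ^ p` added to its `i`-th component. -/
def perturb (p : ℕ) : Signal m := u + Pi.single i (X ^ p)

theorem extendedInput_perturb (p : ℕ) :
    extendedInput (perturb u i p) = extendedInput u + Pi.single i.succ (X ^ p) := by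
  ext1 j
  cases j using Fin.cases <;> simp [extendedInput, perturb, Pi.single_apply]

variable (c : ScalarSeries m)

theorem coeff_scalarFliess_perturb {p q : ℕ} (h : q ≤ p) :
    coeff q (scalarFliess (perturb u i p) c) = coeff q (scalarFliess u c) := by
  have extendedInput_smodEq (j : Fin (m + 1)) :
      extendedInput (perturb u i p) j ≡ extendedInput u j [SMOD truncIdeal ℝ p] := by
    refine smodEq_truncIdeal_iff.mpr fun k hk => ?_
    by_cases hj : j = i.succ <;> simp [extendedInput_perturb, hj, coeff_X_pow, hk.ne]
  exact smodEq_truncIdeal_iff.mp (scalarFliess_smodEq_of_smodEq c extendedInput_smodEq) q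
    (Nat.lt_succ_of_le h)

/-- The difference quotient `(F_c[u + X ^ p e_i] - F_c[u]) / X ^ p`. -/
def perturbQuotient (p : ℕ) : ℝ⟦X⟧ :=
  PowerSeries.mk fun q => coeff (p + q) (scalarFliess (perturb u i p) c - scalarFliess u c)

theorem X_pow_mul_perturbQuotient (p : ℕ) :
    X ^ p * perturbQuotient u i c p = scalarFliess (perturb u i p) c - scalarFliess u c := by
  ext n
  rw [coeff_X_pow_mul', perturbQuotient, coeff_mk]
  split_ifs with hpn
  · rw [Nat.add_sub_cancel' hpn]
  · rw [map_sub, coeff_scalarFliess_perturb u i c (le_of_not_ge hpn), sub_self]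

theorem coeff_zero_perturbQuotient (p : ℕ) : coeff 0 (perturbQuotient u i c p) = 0 := by
  rw [perturbQuotient, coeff_mk, add_zero, map_sub, coeff_scalarFliess_perturb u i c le_rfl,
    sub_self]

theorem derivative_X_pow_mul_perturbQuotient (p : ℕ) :
    d⁄dX ℝ (X ^ p * perturbQuotient u i c p) =
      X ^ p * (∑ j, extendedInput u j * perturbQuotient u i (shift j c) p +
        scalarFliess (perturb u i p) (shift i.succ c)) := by
  have sum_single (f : Fin (m + 1) → ℝ⟦X⟧) :
      ∑ j, (Pi.single i.succ (X ^ p) : Fin (m + 1) → ℝ⟦X⟧) j * f j = X ^ p * f i.succ := by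
    simp [Pi.single_apply]
  simp only [X_pow_mul_perturbQuotient, map_sub, derivative_scalarFliess, mul_add, Finset.mul_sum,
    mul_left_comm (X ^ p), extendedInput_perturb, Pi.add_apply, add_mul, Finset.sum_add_distrib,
    mul_sub, Finset.sum_sub_distrib, sum_single]
  ring

theorem coeff_succ_perturbQuotient (p q : ℕ) :
    ((p : ℝ) + q + 1) * coeff (q + 1) (perturbQuotient u i c p) =
      ∑ j, coeff q (extendedInput u j * perturbQuotient u i (shift j c) p) +
        coeff q (scalarFliess (perturb u i p) (shift i.succ c)) := by
  have h := congrArg (coeff (q + p)) (derivative_X_pow_mul_perturbQuotient u i c p)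
  rw [coeff_derivative, add_right_comm, coeff_X_pow_mul, coeff_X_pow_mul, map_add, map_sum,
    mul_comm] at h
  rw [← h, Nat.cast_add, add_comm (p : ℝ)]

theorem tendsto_coeff_succ_perturbQuotient {q : ℕ}
    (h : ∀ k ≤ q, ∀ c, Tendsto (fun p => coeff k (perturbQuotient u i c p)) atTop (𝓝 0)) :
    Tendsto (fun p : ℕ => ((p : ℝ) + q + 1) * coeff (q + 1) (perturbQuotient u i c p)) atTop
      (𝓝 (coeff q (scalarFliess u (shift i.succ c)))) := by
  have tendsto_coeff_mul (j : Fin (m + 1)) :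
      Tendsto (fun p => coeff q (extendedInput u j * perturbQuotient u i (shift j c) p)) atTop
        (𝓝 0) := by
    simp only [coeff_mul]
    rw [← Finset.sum_const_zero (s := Finset.HasAntidiagonal.antidiagonal q)]
    refine tendsto_finsetSum _ fun k hk => ?_
    simpa using (h k.2 (Finset.HasAntidiagonal.antidiagonal.snd_le hk) (shift j c)).const_mul
      (coeff k.1 (extendedInput u j))
  have coeff_eventually_const : ∀ᶠ p in atTop, coeff q (scalarFliess u (shift i.succ c)) =
      coeff q (scalarFliess (perturb u i p) (shift i.succ c)) := by
    filter_upwards [eventually_ge_atTop q] with p hp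
    exact (coeff_scalarFliess_perturb u i _ hp).symm
  simp only [coeff_succ_perturbQuotient]
  simpa using (tendsto_finsetSum Finset.univ fun j _ => tendsto_coeff_mul j).add
    (tendsto_const_nhds.congr' coeff_eventually_const)

theorem tendsto_coeff_perturbQuotient (q : ℕ) :
    Tendsto (fun p => coeff q (perturbQuotient u i c p)) atTop (𝓝 0) := by
  induction q using Nat.strong_induction_on generalizing c with
  | _ q ih =>
    cases q with
    | zero => simp only [coeff_zero_perturbQuotient, tendsto_const_nhds]
    | succ q =>
      have tendsto_mul := tendsto_coeff_succ_perturbQuotient u i c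
        fun k hk c => ih k (Nat.lt_succ_of_le hk) c
      have tendsto_factor : Tendsto (fun p : ℕ => (p : ℝ) + q + 1) atTop atTop :=
        tendsto_atTop_add_const_right _ _
          (tendsto_atTop_add_const_right _ _ tendsto_natCast_atTop_atTop)
      refine (tendsto_mul.div_atTop tendsto_factor).congr fun p => ?_
      exact mul_div_cancel_left₀ _ (by positivity)

variable {c}

theorem scalarFliess_shift_eq_zero (h : ∀ u, scalarFliess u c = 0) (i : Fin (m + 1)) :
    scalarFliess u (shift i c) = 0 := by
  have shift_succ (i : Fin m) : scalarFliess u (shift i.succ c) = 0 := by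
    have perturbQuotient_eq_zero (p : ℕ) : perturbQuotient u i c p = 0 := by
      ext q
      simp [perturbQuotient, h]
    ext q
    refine tendsto_nhds_unique (tendsto_coeff_succ_perturbQuotient u i c
      fun k _ c => tendsto_coeff_perturbQuotient u i c k) ?_
    simp [perturbQuotient_eq_zero]
  cases i using Fin.cases with
  | succ i => exact shift_succ i
  | zero =>
    have derivative_eq := derivative_scalarFliess u c
    rw [h, map_zero, Fin.sum_univ_succ] at derivative_eq
    simpa [shift_succ, extendedInput] using derivative_eq.symm

theorem eq_zero_of_scalarFliess_eq_zero (h : ∀ u, scalarFliess u c = 0) : c = 0 := by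
  ext η
  induction η generalizing c with
  | nil => rw [← constantCoeff_scalarFliess 0 c, h, map_zero, Pi.zero_apply]
  | cons i _ ih => exact ih fun u => scalarFliess_shift_eq_zero u h i

theorem fliess_injective {ℓ : ℕ} :
    Function.Injective (fliess : Series m ℓ → Signal m → Signal ℓ) := by
  intro c d h
  have component_sub_eq_zero (k : Fin ℓ) : component c k - component d k = 0 :=
    eq_zero_of_scalarFliess_eq_zero fun u => by
      rw [map_sub, ← fliess_apply, ← fliess_apply, h, sub_self]
  ext η k
  exact sub_eq_zero.mp (congrFun (component_sub_eq_zero k) η)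

end Injective

/-! ### The output feedback group -/

theorem exists_fixedPoint_of_wellFounded {α β : Type*} [Nonempty β] {r : α → α → Prop}
    (hr : WellFounded r) {T : (α → β) → α → β}
    (hT : ∀ f g x, (∀ y, r y x → f y = g y) → T f x = T g x) : ∃ f, T f = f := by
  classical
  let step (x : α) (rec : ∀ y, r y x → β) : β :=
    T (fun y => if h : r y x then rec y h else Classical.arbitrary β) x
  refine ⟨hr.fix step, funext fun x => ?_⟩
  rw [hr.fix_eq]
  exact hT _ _ x fun y hy => by rw [dif_pos hy]

theorem fliess_add {m ℓ : ℕ} (c d : Series m ℓ) (u : Signal m) :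
    fliess (c + d) u = fliess c u + fliess d u :=
  funext fun k => map_add (scalarFliess u) (component c k) (component d k)

theorem fliess_neg {m ℓ : ℕ} (c : Series m ℓ) (u : Signal m) : fliess (-c) u = -fliess c u :=
  funext fun k => map_neg (scalarFliess u) (component c k)

theorem fliess_zero {m ℓ : ℕ} (u : Signal m) : fliess (0 : Series m ℓ) u = 0 :=
  funext fun _ => map_zero (scalarFliess u)

namespace DeltaSeries

variable {m : ℕ}

/-- The operator `u ↦ u + F_c[u]` generated by `δ + c`. -/
instance : SMul (DeltaSeries m) (Signal m) := ⟨fun a u => u + fliess a.series u⟩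

theorem smul_def (a : DeltaSeries m) (u : Signal m) : a • u = u + fliess a.series u := rfl

theorem series_one : (1 : DeltaSeries m).series = 0 := rfl

theorem series_mul (a b : DeltaSeries m) :
    (a * b).series = b.series + modComp a.series b.series := rfl

instance : FaithfulSMul (DeltaSeries m) (Signal m) where
  eq_of_smul_eq_smul h := DeltaSeries.ext (fliess_injective (funext fun u =>
    add_left_cancel (h u)))

protected theorem one_smul (u : Signal m) : (1 : DeltaSeries m) • u = u := by
  rw [smul_def, series_one, fliess_zero, add_zero]

protected theorem mul_smul (a b : DeltaSeries m) (u : Signal m) : (a * b) • u = a • b • u := by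
  simp only [smul_def, series_mul, fliess_add, fliess_modComp, add_assoc]

instance : Monoid (DeltaSeries m) where
  mul_assoc a b c := eq_of_smul_eq_smul fun u : Signal m => by simp only [DeltaSeries.mul_smul]
  one_mul a := eq_of_smul_eq_smul fun u : Signal m => by
    rw [DeltaSeries.mul_smul, DeltaSeries.one_smul]
  mul_one a := eq_of_smul_eq_smul fun u : Signal m => by
    rw [DeltaSeries.mul_smul, DeltaSeries.one_smul]

theorem exists_mul_eq_one (a : DeltaSeries m) : ∃ b, a * b = 1 := by
  obtain ⟨b, hb⟩ := exists_fixedPoint_of_wellFounded (T := fun b => -modComp a.series b)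
    (measure List.length).wf fun b b' η h => congrArg Neg.neg (modComp_congr a.series h)
  refine ⟨⟨b⟩, DeltaSeries.ext ?_⟩
  rw [series_mul, series_one, ← neg_eq_iff_add_eq_zero, neg_eq_iff_eq_neg]
  exact hb.symm

theorem exists_inverse (a : DeltaSeries m) : ∃ b, a * b = 1 ∧ b * a = 1 := by
  obtain ⟨b, hab⟩ := exists_mul_eq_one a
  obtain ⟨c, hbc⟩ := exists_mul_eq_one b
  exact ⟨b, hab, left_inv_eq_right_inv hab hbc ▸ hbc⟩

instance : Group (DeltaSeries m) where
  inv_mul_cancel a := (Classical.epsilon_spec (exists_inverse a)).2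

instance : MulAction (DeltaSeries m) (Signal m) where
  one_smul := DeltaSeries.one_smul
  mul_smul := DeltaSeries.mul_smul

end DeltaSeries

/-! ### The feedback product -/

section Feedback

variable {mc md : ℕ} {c : Series mc md} {d : Series md mc} {e : Series mc md}

theorem isFeedbackSeries_iff_forall :
    IsFeedbackSeries c d e ↔ ∀ u y, y = fliess c (u + fliess d y) ↔ y = fliess e u := by
  simp only [IsFeedbackSeries, exists_eq_left]

variable (c d) in
theorem isFeedbackSeries_modComp_groupInv :
    IsFeedbackSeries c d (modComp c (groupInv (-comp d c))) := by
  intro u y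
  let a : DeltaSeries mc := ⟨-comp d c⟩
  have loop_iff (v : Signal mc) : v = u + fliess d (fliess c v) ↔ v = a⁻¹ • u := by
    rw [eq_inv_smul_iff, DeltaSeries.smul_def, fliess_neg, fliess_comp, ← sub_eq_add_neg,
      sub_eq_iff_eq_add]
  calc (∃ v, v = u + fliess d y ∧ y = fliess c v)
      ↔ ∃ v, v = a⁻¹ • u ∧ y = fliess c v :=
        exists_congr fun v => and_congr_left fun hy => by rw [← loop_iff, hy]
    _ ↔ y = fliess c (a⁻¹ • u) := exists_eq_left
    _ ↔ y = fliess (modComp c (groupInv (-comp d c))) u := by rw [fliess_modComp]; rfl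

theorem isFeedbackSeries_iff : IsFeedbackSeries c d e ↔ e = feedback c d := by
  have h : IsFeedbackSeries c d (feedback c d) :=
    Classical.epsilon_spec ⟨_, isFeedbackSeries_modComp_groupInv c d⟩
  refine ⟨fun he => fliess_injective (funext fun u => ?_), fun he => he ▸ h⟩
  exact (h u _).mp ((he u _).mpr rfl)

theorem feedback_eq : feedback c d = modComp c (groupInv (-comp d c)) :=
  (isFeedbackSeries_iff.mp (isFeedbackSeries_modComp_groupInv c d)).symm

theorem eq_modComp_comp_iff : e = modComp c (comp d e) ↔ e = feedback c d := by
  have h := isFeedbackSeries_iff_forall.mp (isFeedbackSeries_iff (c := c) (d := d).mpr rfl)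
  rw [← fliess_injective.eq_iff, ← fliess_injective.eq_iff, funext_iff, funext_iff]
  exact forall_congr' fun u => by rw [fliess_modComp, fliess_comp, h]

end Feedback

end FliessSeries

end

theorem mainTheorem3 (mc md : ℕ) (c : Series mc md) (d : Series md mc) :
    -- `(DeltaSeries mc, ∘, δ)` is a group and `⁻¹` is its inverse
    ((∀ a b e : DeltaSeries mc, a * b * e = a * (b * e)) ∧
      (∀ a : DeltaSeries mc, 1 * a = a ∧ a * 1 = a) ∧
      (∀ a : DeltaSeries mc, a * a⁻¹ = 1 ∧ a⁻¹ * a = 1)) ∧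
    -- `c @ d` is the unique generating series of the feedback connection
    (∀ e : Series mc md, IsFeedbackSeries c d e ↔ e = feedback c d) ∧
    -- equivalently, the unique fixed point of the loop map on series
    (∀ e : Series mc md, e = modComp c (comp d e) ↔ e = feedback c d) ∧
    -- the feedback product formulas
    feedback c d = modComp c (groupInv (-comp d c)) ∧
    feedback c d = compDelta c (⟨-comp d c⟩ : DeltaSeries mc)⁻¹ :=
  ⟨⟨mul_assoc, fun a => ⟨one_mul a, mul_one a⟩, fun a => ⟨mul_inv_cancel a, inv_mul_cancel a⟩⟩,
    fun _ => isFeedbackSeries_iff, fun _ => eq_modComp_comp_iff, feedback_eq,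
    feedback_eq.trans (compDelta_eq_modComp c _).symm⟩
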